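/- A seller with type \(x\in X=\{1,\dots,\bar x\}\) can sell an indivisible good to a buyer with type \(y\in Y=\{1,\dots,\bar y\}\). Types are private information and independent, with full-support laws \(p_1\) on \(X\) and \(p_2\) on \(Y\). Trader \(i\)'s valuation is \(v_i^1(x)+v_i^2(y)\ge 0\), where \(v_i^i\) is strictly increasing and \(v_i^j\) (\(j\neq i\)) is nondecreasing. At an outcome \((q,t)\in[0,1]\times\mathbb R\) (transfer probability, payment to the seller) the seller's payoff is \(t+(v_1^1(x)+v_1^2(y))(1-q)\) and the buyer's payoff is \((v_2^1(x)+v_2^2(y))q-t\); no trade is \((0,0)\). An allocation is a map \(g=(q,t):X\times Y\to[0,1]\times\mathbb R\), viewed as a direct mechanism; \(U_1^g(x)\) is the truthful interim payoff of seller type \(x\) (expectation over \(y\sim p_2\)). For \(\pi_1\in\Delta(X)\), \(g\) is \(\pi_1\)-feasible if it is Bayesian incentive compatible and interim individually rational for the seller (outside payoff \(v_1^1(x)+E_y[v_1^2(y)]\)) and for the buyer with belief \(\pi_1\) about \(x\) (outside payoff \(0\)); it is feasible if it is \(p_1\)-feasible. \(g'\) dominates \(g\) if \(U_1^{g'}\ge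 U_1^{g}\) at every type, with strict inequality at some type. A feasible allocation is undominated if no feasible allocation dominates it. An RSW allocation is an allocation that, for every \(x\) simultaneously, maximizes \(U_1^g(x)\) over all allocations \(g\) that are Bayesian incentive compatible for the seller and ex post incentive compatible and ex post individually rational for the buyer (at every \((x,y)\)). A strong solution is an undominated RSW allocation. A mechanism \(G\) consists of finite action sets \(S_1,S_2\) and an outcome function on \(S_1\times S_2\) with values in \([0,1]\times\mathbb R\). \(BR(\pi_1,G)\) is the set of allocations induced by sequential equilibria of the continuation game in which \(G\) has been offered and the buyer has belief \(\pi_1\) about \(x\): the buyer accepts or rejects, rejection gives no trade, and after acceptance both players simultaneously choose actions. An allocation \(g\) passes the Farrell–Grossman–Perry (FGP) criterion if \(g\) is feasible and there are no allocation \(g'\), mechanism \(G\) and belief \(\pi_1\in\Pi_1\) such that \(U_1^{g'}(x')>U_1^g(x')\) for some \(x'\in X\) and \(g'\in BR(\pi_1,G)\). Here, with \(Z=\{x: U_1^{g'}(x)>U_1^g(x)\}\) and \(Z^0=\{x:U_1^{g'}(x)=U_1^g(x)\}\), \(\Pi_1\) is the set of probability distributions \(\pi_1\) on \(Z\cup Z^0\),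 extended by \(0\) to \(X\), such that \(\pi_1(x)/p_1(x)\le \pi_1(x')/p_1(x')\) for all \(x\in X\) and \(x'\in Z\). Claim. (1) If some allocation passes the FGP criterion, then every RSW allocation is undominated. (2) Every undominated RSW allocation passes the FGP criterion. (3) An allocation that passes the FGP criterion exists if and only if a strong solution exists. -/

import Mathlib

open Filter Topology

noncomputable section

namespace BilateralTrade

/-- The primitives of the trading environment. The seller's types are `Fin m` and the buyer's
types are `Fin n`, both ordered as usual. The type `x` of the seller and the type `y` of the buyer
are independent with laws `p₁`, `p₂` of full support. The seller's valuation is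
`v₁₁ x + v₁₂ y` and the buyer's valuation is `v₂₁ x + v₂₂ y`: in `vᵢⱼ` the first index is the
trader who values the good and the second one is the trader whose type is the argument. -/
structure Environment (m n : ℕ) where
  p₁ : Fin m → ℝ
  p₂ : Fin n → ℝ
  p₁_mem : p₁ ∈ stdSimplex ℝ (Fin m)
  p₂_mem : p₂ ∈ stdSimplex ℝ (Fin n)
  p₁_pos : ∀ x, 0 < p₁ x
  p₂_pos : ∀ y, 0 < p₂ y
  v₁₁ : Fin m → ℝ
  v₁₂ : Fin n → ℝ
  v₂₁ : Fin m → ℝ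
  v₂₂ : Fin n → ℝ
  v₁₁_strictMono : StrictMono v₁₁
  v₂₂_strictMono : StrictMono v₂₂
  v₁₂_mono : Monotone v₁₂
  v₂₁_mono : Monotone v₂₁
  v₁_nonneg : ∀ x y, 0 ≤ v₁₁ x + v₁₂ y
  v₂_nonneg : ∀ x y, 0 ≤ v₂₁ x + v₂₂ y

/-- An outcome function on `A × B`: a probability `q` that the good is transferred and a payment
`t` from the buyer to the seller, for every pair in `A × B`. -/
structure OutcomeFn (A B : Type) where
  q : A → B → ℝ
  t : A → B → ℝ
  q_mem : ∀ a b, q a b ∈ Set.Icc (0 : ℝ) 1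

/-- An allocation (direct mechanism) assigns an outcome to every type profile. -/
abbrev Allocation (m n : ℕ) := OutcomeFn (Fin m) (Fin n)

/-- A mechanism: a finite strategic game form between the seller (actions `S₁`) and the buyer
(actions `S₂`). A player who is inactive has exactly one action. -/
structure Mechanism where
  S₁ : Type
  S₂ : Type
  [fintype₁ : Fintype S₁]
  [fintype₂ : Fintype S₂]
  [nonempty₁ : Nonempty S₁]
  [nonempty₂ : Nonempty S₂]
  out : OutcomeFn S₁ S₂

attribute [instance] Mechanism.fintype₁ Mechanism.fintype₂
  Mechanism.nonempty₁ Mechanism.nonempty₂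

namespace Environment

variable {m n : ℕ} (E : Environment m n)

/-- The seller's ex post payoff from the outcome `(q, t)` at the type profile `(x, y)`. -/
def sellerPayoff (x : Fin m) (y : Fin n) (q t : ℝ) : ℝ :=
  t + (E.v₁₁ x + E.v₁₂ y) * (1 - q)

/-- The buyer's ex post payoff from the outcome `(q, t)` at the type profile `(x, y)`. -/
def buyerPayoff (x : Fin m) (y : Fin n) (q t : ℝ) : ℝ :=
  (E.v₂₁ x + E.v₂₂ y) * q - t

/-- The seller's interim payoff in `g` from reporting `xr` when her type is `x`. -/
def sellerReport (g : Allocation m n) (xr x : Fin m) : ℝ :=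
  ∑ y, E.p₂ y * E.sellerPayoff x y (g.q xr y) (g.t xr y)

/-- The seller's interim payoff `U₁(x)` in `g` under truth-telling. -/
def U₁ (g : Allocation m n) (x : Fin m) : ℝ :=
  E.sellerReport g x x

/-- The buyer's ex post payoff in `g` from reporting `yr` at the type profile `(x, y)`. -/
def buyerReport (g : Allocation m n) (yr : Fin n) (x : Fin m) (y : Fin n) : ℝ :=
  E.buyerPayoff x y (g.q x yr) (g.t x yr)

/-- The buyer's expected payoff in `g` from reporting `yr` when his type is `y` and his belief
about the seller's type is `π₁`. -/
def buyerReportInterim (g : Allocation m n) (π₁ : Fin m → ℝ) (yr y : Fin n) : ℝ :=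
  ∑ x, π₁ x * E.buyerReport g yr x y

/-- `g` is Bayesian incentive compatible for the seller. -/
def BICSeller (g : Allocation m n) : Prop :=
  ∀ x xr, E.sellerReport g xr x ≤ E.U₁ g x

/-- `g` is interim individually rational for the seller. -/
def IIRSeller (g : Allocation m n) : Prop :=
  ∀ x, E.v₁₁ x + ∑ y, E.p₂ y * E.v₁₂ y ≤ E.U₁ g x

/-- `g` is Bayesian incentive compatible for the buyer with belief `π₁`. -/
def BICBuyer (π₁ : Fin m → ℝ) (g : Allocation m n) : Prop :=
  ∀ y yr, E.buyerReportInterim g π₁ yr y ≤ E.buyerReportInterim g π₁ y y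

/-- `g` is interim individually rational for the buyer with belief `π₁`. -/
def IIRBuyer (π₁ : Fin m → ℝ) (g : Allocation m n) : Prop :=
  ∀ y, 0 ≤ E.buyerReportInterim g π₁ y y

/-- `g` is ex post incentive compatible for the buyer. -/
def EPICBuyer (g : Allocation m n) : Prop :=
  ∀ x y yr, E.buyerReport g yr x y ≤ E.buyerReport g y x y

/-- `g` is ex post individually rational for the buyer. -/
def EPIRBuyer (g : Allocation m n) : Prop :=
  ∀ x y, 0 ≤ E.buyerReport g y x y

/-- `g` is `π₁`-feasible. -/
def FeasibleGiven (π₁ : Fin m → ℝ) (g : Allocation m n) : Prop :=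
  E.BICSeller g ∧ E.IIRSeller g ∧ E.BICBuyer π₁ g ∧ E.IIRBuyer π₁ g

/-- `g` is feasible, i.e. feasible given the prior. -/
def Feasible (g : Allocation m n) : Prop :=
  E.FeasibleGiven E.p₁ g

/-- `g'` dominates `g`. -/
def Dominates (g' g : Allocation m n) : Prop :=
  (∀ x, E.U₁ g x ≤ E.U₁ g' x) ∧ ∃ x, E.U₁ g x < E.U₁ g' x

/-- The feasible allocation `g` is undominated given the belief `π₁`. -/
def UndominatedGiven (π₁ : Fin m → ℝ) (g : Allocation m n) : Prop :=
  E.Feasible g ∧ ¬ ∃ g', E.FeasibleGiven π₁ g' ∧ E.Dominates g' g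

/-- The feasible allocation `g` is undominated (given the prior). -/
def Undominated (g : Allocation m n) : Prop :=
  E.UndominatedGiven E.p₁ g

/-- The constraints of the problem that defines RSW allocations. -/
def RSWConstraints (g : Allocation m n) : Prop :=
  E.BICSeller g ∧ E.EPICBuyer g ∧ E.EPIRBuyer g

/-- `g` is a Rothschild–Stiglitz–Wilson allocation: for every seller type `x` it maximizes
`U₁(x)` among the allocations that are BIC for the seller and EPIC and EPIR for the buyer. -/
def IsRSW (g : Allocation m n) : Prop :=
  E.RSWConstraints g ∧ ∀ x, ∀ g', E.RSWConstraints g' → E.U₁ g' x ≤ E.U₁ g x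

/-- A strong solution: an RSW allocation that is undominated given the prior. -/
def IsStrongSolution (g : Allocation m n) : Prop :=
  E.IsRSW g ∧ E.Undominated g

/-- Bayes posterior about the buyer's type after an acceptance, for the acceptance plan `γ`. -/
def acceptPosterior (γ : Fin n → ℝ) (y : Fin n) : ℝ :=
  E.p₂ y * γ y / ∑ y', E.p₂ y' * γ y'

/-- Consistency of the seller's belief `π₂` (after an acceptance) with the buyer's acceptance plan
`γ`: the pair is a limit of totally mixed plans with their Bayes posteriors. Actions are chosen
after all moves that `π₂` is about, so perturbing the action plans puts no restriction on `π₂`. -/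
def ConsistentBelief (γ π₂ : Fin n → ℝ) : Prop :=
  ∃ γseq : ℕ → Fin n → ℝ, (∀ k y, 0 < γseq k y ∧ γseq k y < 1) ∧
    (∀ y, Tendsto (fun k => γseq k y) atTop (𝓝 (γ y))) ∧
    ∀ y, Tendsto (fun k => E.acceptPosterior (γseq k) y) atTop (𝓝 (π₂ y))

/-- Expected continuation payoff, after `G` has been accepted, of the seller of type `x` from the
action `s₁`, given her belief `π₂` and the buyer's action plan `σ₂`. -/
def sellerContinuation (G : Mechanism) (π₂ : Fin n → ℝ) (σ₂ : Fin n → G.S₂ → ℝ)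
    (x : Fin m) (s₁ : G.S₁) : ℝ :=
  ∑ y, π₂ y * ∑ s₂, σ₂ y s₂ * E.sellerPayoff x y (G.out.q s₁ s₂) (G.out.t s₁ s₂)

/-- Expected continuation payoff, after `G` has been accepted, of the buyer of type `y` from the
action `s₂`, given the belief that `(x, s₁)` has probability `π₁ x * σ₁ x s₁`. -/
def buyerContinuation (G : Mechanism) (π₁ : Fin m → ℝ) (σ₁ : Fin m → G.S₁ → ℝ)
    (y : Fin n) (s₂ : G.S₂) : ℝ :=
  ∑ x, π₁ x * ∑ s₁, σ₁ x s₁ * E.buyerPayoff x y (G.out.q s₁ s₂) (G.out.t s₁ s₂)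

/-- `(γ, σ₁, σ₂)` with the belief `π₂` is a sequential equilibrium of the continuation game in
which the mechanism `G` has been offered and the buyer believes that the seller's type has law
`π₁`: the buyer of type `y` accepts with probability `γ y` (a rejection gives the no-trade outcome
and hence the payoff `0` to the buyer); after an acceptance both players choose their actions
simultaneously. Every type of both players, also a type of probability zero, is optimizing at
each of its information sets, on and off the path. -/
structure IsSequentialEquilibrium (π₁ : Fin m → ℝ) (G : Mechanism) (γ : Fin n → ℝ)
    (σ₁ : Fin m → G.S₁ → ℝ) (σ₂ : Fin n → G.S₂ → ℝ) (π₂ : Fin n → ℝ) : Prop where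
  accept_mem : ∀ y, γ y ∈ Set.Icc (0 : ℝ) 1
  seller_mixed : ∀ x, σ₁ x ∈ stdSimplex ℝ G.S₁
  buyer_mixed : ∀ y, σ₂ y ∈ stdSimplex ℝ G.S₂
  consistent : E.ConsistentBelief γ π₂
  seller_optimal : ∀ x s₁', E.sellerContinuation G π₂ σ₂ x s₁' ≤
    ∑ s₁, σ₁ x s₁ * E.sellerContinuation G π₂ σ₂ x s₁
  buyer_optimal : ∀ y s₂', E.buyerContinuation G π₁ σ₁ y s₂' ≤
    ∑ s₂, σ₂ y s₂ * E.buyerContinuation G π₁ σ₁ y s₂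
  accept_optimal : ∀ y, ∀ a ∈ Set.Icc (0 : ℝ) 1,
    a * (∑ s₂, σ₂ y s₂ * E.buyerContinuation G π₁ σ₁ y s₂) ≤
      γ y * ∑ s₂, σ₂ y s₂ * E.buyerContinuation G π₁ σ₁ y s₂

/-- The set `BR(π₁, G)` of the allocations that are induced by the sequential equilibria of the
continuation game given `(π₁, G)`. -/
def BR (π₁ : Fin m → ℝ) (G : Mechanism) : Set (Allocation m n) :=
  {g | ∃ (γ : Fin n → ℝ) (σ₁ : Fin m → G.S₁ → ℝ) (σ₂ : Fin n → G.S₂ → ℝ) (π₂ : Fin n → ℝ),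
    E.IsSequentialEquilibrium π₁ G γ σ₁ σ₂ π₂ ∧
    (∀ x y, g.q x y = γ y * ∑ s₁, ∑ s₂, σ₁ x s₁ * σ₂ y s₂ * G.out.q s₁ s₂) ∧
    ∀ x y, g.t x y = γ y * ∑ s₁, ∑ s₂, σ₁ x s₁ * σ₂ y s₂ * G.out.t s₁ s₂}

/-- The set `Π₁` of beliefs for a deviation from `g` to `g'`: probability distributions on the
types that weakly gain, such that the likelihood ratio to the prior is at each type that strictly
gains at least as large as at any other type. -/
def credibleBeliefs (g g' : Allocation m n) : Set (Fin m → ℝ) :=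
  {π₁ | π₁ ∈ stdSimplex ℝ (Fin m) ∧
    (∀ x, ¬ (E.U₁ g x < E.U₁ g' x ∨ E.U₁ g' x = E.U₁ g x) → π₁ x = 0) ∧
    ∀ x x', E.U₁ g x' < E.U₁ g' x' → π₁ x / E.p₁ x ≤ π₁ x' / E.p₁ x'}

/-- `g` passes the Farrell–Grossman–Perry criterion. -/
def PassesFGP (g : Allocation m n) : Prop :=
  E.Feasible g ∧ ¬ ∃ g' : Allocation m n, (∃ x', E.U₁ g x' < E.U₁ g' x') ∧
    ∃ G : Mechanism, ∃ π₁ ∈ E.credibleBeliefs g g', g' ∈ E.BR π₁ G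

end Environment

end BilateralTrade

end

/-!
By the revelation principle, the allocations that a buyer with belief `π₁` may grant are the
direct mechanisms that are incentive compatible for both traders and individually rational for the
buyer. If such an allocation were a credible deviation from an undominated RSW allocation, then
letting the types deviate with the probabilities from which Bayes' rule derives `π₁` would yield a
dominating allocation: the types who stay put cannot upset the buyer, since the RSW constraints
hold ex post.

Conversely, let `g` pass the criterion. No type's revenue falls short of the revenue that she could
earn in her own name with a monotone schedule of the same trade probability. Otherwise she and the
higher types who are indifferent to imitating her would deviate to slightly less trade, and a
buyer who expects only these types would agree. For the buyer-monotone rearrangement of `g` with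
the same marginals, these revenues sum under the prior to an upper bound on the total revenue of
`g`. Hence all of the inequalities are equalities, and the rearrangement is an RSW allocation with
the payoffs of `g`.
-/

namespace BilateralTrade

section FiniteSums

variable {ι : Type*} [Fintype ι]

lemma sum_mul_le_of_mem_stdSimplex {w f : ι → ℝ} {c : ℝ} (hw : w ∈ stdSimplex ℝ ι)
    (hf : ∀ i, f i ≤ c) : ∑ i, w i * f i ≤ c :=
  (convex_Iic c).sum_mem (fun i _ => hw.1 i) hw.2 fun i _ => hf i

lemma sum_mul_eq_zero_iff_of_pos {w f : ι → ℝ} (hw : ∀ i, 0 < w i) (hf : ∀ i, 0 ≤ f i) :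
    ∑ i, w i * f i = 0 ↔ ∀ i, f i = 0 := by
  rw [Finset.sum_eq_zero_iff_of_nonneg fun i _ => mul_nonneg (hw i).le (hf i)]
  simp only [Finset.mem_univ, true_imp_iff, mul_eq_zero, (hw _).ne', false_or]

lemma sum_sum_mul_affine {κ : Type*} [Fintype κ] (a : ι → ℝ) (b : κ → ℝ) (q t : ι → κ → ℝ)
    (v : ℝ) :
    ∑ i, a i * ∑ j, b j * (v * q i j - t i j) =
      v * ∑ i, ∑ j, a i * b j * q i j - ∑ i, ∑ j, a i * b j * t i j := by
  simp only [Finset.mul_sum, ← Finset.sum_sub_distrib]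
  exact Finset.sum_congr rfl fun i _ => Finset.sum_congr rfl fun j _ => by ring

end FiniteSums

section SmallPerturbations

lemma eventually_lt_add_mul_iff {ι : Type*} [Finite ι] {u ℓ : ι → ℝ} (hℓ : ∀ i, ℓ i ≤ u i)
    (d : ι → ℝ) : ∀ᶠ ε : ℝ in 𝓝[>] 0, ∀ i, u i < ℓ i + ε * d i ↔ ℓ i = u i ∧ 0 < d i := by
  refine eventually_all.2 fun i => ?_
  rcases (hℓ i).eq_or_lt with heq | hlt
  · filter_upwards [self_mem_nhdsWithin] with ε hε
    rw [heq, lt_add_iff_pos_right, mul_pos_iff_of_pos_left hε, eq_self, true_and]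
  · have hcont : Continuous fun ε : ℝ => ℓ i + ε * d i := by fun_prop
    have hlim : ∀ᶠ ε : ℝ in 𝓝 0, ℓ i + ε * d i < u i :=
      hcont.continuousAt.eventually_lt continuousAt_const (by simpa using hlt)
    filter_upwards [nhdsWithin_le_nhds hlim] with ε hε
    simp only [hε.not_gt, hlt.ne, false_and]

lemma exists_lt_apply_iff_le {ι : Type*} [LinearOrder ι] [PredOrder ι] {φ : ι → ℝ}
    (hφ : StrictMono φ) (i : ι) : ∃ c, ∀ j, c < φ j ↔ i ≤ j := by
  by_cases hi : IsMin i
  · refine ⟨φ i - 1, fun j => iff_of_true ?_ (hi.isBot j)⟩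
    linarith [hφ.monotone (hi.isBot j)]
  · exact ⟨φ (Order.pred i), fun j => hφ.lt_iff_lt.trans (Order.pred_lt_iff_of_not_isMin hi)⟩

end SmallPerturbations

section Exchange

variable {κ : Type*} [DecidableEq κ] {b : κ → ℝ} {y₁ y₂ : κ}

/-- The direction in which a row moves when mass is shifted from column `y₂` to column `y₁`
without changing the row sum with weights `b`. It is scaled so that adding it `s y₂ - s y₁` times
to a row `s` replaces both entries by their weighted mean. -/
noncomputable def exchange (b : κ → ℝ) (y₁ y₂ : κ) : κ → ℝ :=
  (b y₁ + b y₂)⁻¹ • (Pi.single y₁ (b y₂) - Pi.single y₂ (b y₁))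

lemma exchange_left (hy : y₁ ≠ y₂) : exchange b y₁ y₂ y₁ = b y₂ / (b y₁ + b y₂) := by
  simp [exchange, hy, div_eq_inv_mul]

lemma exchange_right (hy : y₁ ≠ y₂) : exchange b y₁ y₂ y₂ = -(b y₁ / (b y₁ + b y₂)) := by
  simp [exchange, hy.symm, div_eq_inv_mul]

lemma exchange_of_ne {y : κ} (h₁ : y ≠ y₁) (h₂ : y ≠ y₂) : exchange b y₁ y₂ y = 0 := by
  simp [exchange, h₁, h₂]

lemma add_mul_exchange_mem_Icc (hb : ∀ y, 0 < b y) (hy : y₁ ≠ y₂) {s : κ → ℝ} {c d θ : ℝ}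
    (hs : ∀ y, s y ∈ Set.Icc c d) (hθ : θ ∈ Set.Icc (0 : ℝ) 1) (y : κ) :
    s y + θ * (s y₂ - s y₁) * exchange b y₁ y₂ y ∈ Set.Icc c d := by
  have hweight : ∀ {u v : ℝ}, 0 < u → 0 < v → θ * (u / (u + v)) ∈ Set.Icc (0 : ℝ) 1 :=
    fun {u v} hu hv => unitInterval.mul_mem hθ
      ⟨by positivity, (div_le_one (by positivity)).2 (by linarith)⟩
  have hconvex : ∀ {w : ℝ} {z z' : κ}, w ∈ Set.Icc (0 : ℝ) 1 →
      s z + w * (s z' - s z) ∈ Set.Icc c d := fun hw =>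
    (convex_Icc c d).add_smul_sub_mem (hs _) (hs _) hw
  by_cases h₁ : y = y₁
  · subst h₁
    rw [exchange_left hy]
    convert hconvex (z := y) (z' := y₂) (hweight (hb y₂) (hb y)) using 1
    ring
  by_cases h₂ : y = y₂
  · subst h₂
    rw [exchange_right hy]
    convert hconvex (z := y) (z' := y₁) (hweight (hb y₁) (hb y)) using 1
    ring
  · simpa only [exchange_of_ne h₁ h₂, mul_zero, add_zero] using hs y

variable [Fintype κ]

lemma sum_mul_exchange_mul (f : κ → ℝ) :
    ∑ y, b y * (exchange b y₁ y₂ y * f y) = b y₁ * b y₂ / (b y₁ + b y₂) * (f y₁ - f y₂) := by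
  simp only [exchange, Pi.smul_apply, Pi.sub_apply, Pi.single_apply, smul_eq_mul, sub_mul, mul_sub,
    ite_mul, mul_ite, zero_mul, mul_zero, Finset.sum_sub_distrib, Finset.sum_ite_eq',
    Finset.mem_univ, if_true]
  ring

lemma sum_mul_exchange : ∑ y, b y * exchange b y₁ y₂ y = 0 := by
  simpa using sum_mul_exchange_mul (b := b) (y₁ := y₁) (y₂ := y₂) fun _ => 1

lemma sum_mul_sq_add_mul_exchange (hb : ∀ y, 0 < b y) (hy : y₁ ≠ y₂) (s : κ → ℝ) (θ : ℝ) :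
    ∑ y, b y * (s y + θ * (s y₂ - s y₁) * exchange b y₁ y₂ y) ^ 2 =
      ∑ y, b y * s y ^ 2 -
        b y₁ * b y₂ / (b y₁ + b y₂) * (θ * (2 - θ)) * (s y₂ - s y₁) ^ 2 := by
  set k := exchange b y₁ y₂ with hk
  have hunit : k y₁ - k y₂ = 1 := by
    have : b y₁ + b y₂ ≠ 0 := (add_pos (hb y₁) (hb y₂)).ne'
    rw [hk, exchange_left hy, exchange_right hy]
    field_simp
    ring
  calc ∑ y, b y * (s y + θ * (s y₂ - s y₁) * k y) ^ 2
      = ∑ y, b y * s y ^ 2 + 2 * (θ * (s y₂ - s y₁)) * ∑ y, b y * (k y * s y) +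
          (θ * (s y₂ - s y₁)) ^ 2 * ∑ y, b y * (k y * k y) := by
        simp only [Finset.mul_sum, ← Finset.sum_add_distrib]
        exact Finset.sum_congr rfl fun y _ => by ring
    _ = _ := by
        rw [sum_mul_exchange_mul, sum_mul_exchange_mul, hunit]
        ring

lemma sum_mul_sum_mul_sq_add_mul_exchange_lt {ι : Type*} [Fintype ι] {a θ : ι → ℝ}
    {r : ι → κ → ℝ} (ha : ∀ x, 0 < a x) (hb : ∀ y, 0 < b y) (hy : y₁ ≠ y₂)
    (hθ : ∀ x, θ x ∈ Set.Icc (0 : ℝ) 1) {x₁ : ι} (hθ₁ : 0 < θ x₁) (hr : r x₁ y₂ ≠ r x₁ y₁) :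
    ∑ x, a x * ∑ y, b y * (r x y + θ x * (r x y₂ - r x y₁) * exchange b y₁ y₂ y) ^ 2 <
      ∑ x, a x * ∑ y, b y * r x y ^ 2 := by
  simp only [sum_mul_sq_add_mul_exchange hb hy]
  have hC : 0 < b y₁ * b y₂ / (b y₁ + b y₂) :=
    div_pos (mul_pos (hb y₁) (hb y₂)) (add_pos (hb y₁) (hb y₂))
  have hθ₂ : ∀ x, 0 < 2 - θ x := fun x => by linarith [(hθ x).2]
  refine Finset.sum_lt_sum (fun x _ => ?_) ⟨x₁, Finset.mem_univ _, ?_⟩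
  · refine mul_le_mul_of_nonneg_left (sub_le_self _ ?_) (ha x).le
    exact mul_nonneg (mul_nonneg hC.le (mul_nonneg (hθ x).1 (hθ₂ x).le)) (sq_nonneg _)
  · refine mul_lt_mul_of_pos_left (sub_lt_self _ ?_) (ha x₁)
    exact mul_pos (mul_pos hC (mul_pos hθ₁ (hθ₂ x₁))) (sq_pos_of_ne_zero (sub_ne_zero.2 hr))

end Exchange

section SameMarginals

variable {ι κ : Type*} [Fintype ι] [Fintype κ]

/-- The set of arrays with entries in `[0, 1]` that have the same column sums with weights `a` and
the same row sums with weights `b` as `q`. -/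
def sameMarginals (a : ι → ℝ) (b : κ → ℝ) (q : ι → κ → ℝ) : Set (ι → κ → ℝ) :=
  {r | (∀ x y, r x y ∈ Set.Icc (0 : ℝ) 1) ∧ (∀ y, ∑ x, a x * r x y = ∑ x, a x * q x y) ∧
    ∀ x, ∑ y, b y * r x y = ∑ y, b y * q x y}

lemma isCompact_sameMarginals (a : ι → ℝ) (b : κ → ℝ) (q : ι → κ → ℝ) :
    IsCompact (sameMarginals a b q) := by
  have hcube : IsCompact (Set.univ.pi fun _ : ι => Set.univ.pi fun _ : κ => Set.Icc (0 : ℝ) 1) :=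
    isCompact_univ_pi fun _ => isCompact_univ_pi fun _ => isCompact_Icc
  refine hcube.of_isClosed_subset ?_ fun r hr x _ y _ => hr.1 x y
  simp only [sameMarginals, Set.ofPred_and, Set.ofPred_forall]
  refine (isClosed_iInter fun x => isClosed_iInter fun y => ?_).inter
    ((isClosed_iInter fun y => ?_).inter (isClosed_iInter fun x => ?_))
  · exact isClosed_Icc.preimage (by fun_prop)
  · exact isClosed_eq (by fun_prop) continuous_const
  · exact isClosed_eq (by fun_prop) continuous_const

lemma exists_unitInterval_weights_sum_eq_zero {a d : ι → ℝ} (ha : ∀ i, 0 ≤ a i)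
    (hsum : 0 ≤ ∑ i, a i * d i) :
    ∃ θ : ι → ℝ, (∀ i, θ i ∈ Set.Icc (0 : ℝ) 1) ∧ (∀ i, d i < 0 → θ i = 1) ∧
      ∑ i, a i * (θ i * d i) = 0 := by
  set N := ∑ i, a i * (d i)⁻ with hN
  set P := ∑ i, a i * (d i)⁺ with hP
  have hN₀ : 0 ≤ N := Finset.sum_nonneg fun i _ => mul_nonneg (ha i) (negPart_nonneg _)
  have hNP : N ≤ P := by
    rw [← sub_nonneg, hP, hN, ← Finset.sum_sub_distrib]
    simpa only [← mul_sub, posPart_sub_negPart] using hsum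
  have hratio : N / P * P = N := by
    rcases (hN₀.trans hNP).eq_or_lt with hP₀ | hP₀
    · rw [← hP₀, mul_zero]
      linarith
    · exact div_mul_cancel₀ N hP₀.ne'
  refine ⟨fun i => if d i < 0 then 1 else N / P, fun i => ?_, fun i hi => if_pos hi, ?_⟩
  · dsimp only
    split_ifs
    · exact Set.right_mem_Icc.2 zero_le_one
    · exact ⟨div_nonneg hN₀ (hN₀.trans hNP), div_le_one_of_le₀ hNP (hN₀.trans hNP)⟩
  · have hterm : ∀ i, a i * ((if d i < 0 then 1 else N / P) * d i) =
        N / P * (a i * (d i)⁺) - a i * (d i)⁻ := fun i => by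
      split_ifs with hi
      · rw [posPart_eq_zero.2 hi.le, negPart_eq_neg.2 hi.le]
        ring
      · rw [posPart_eq_self.2 (not_lt.1 hi), negPart_eq_zero.2 (not_lt.1 hi)]
        ring
    simp only [hterm, Finset.sum_sub_distrib, ← Finset.mul_sum]
    rw [hratio, sub_self]

/-- A minimizer of a strictly convex function of the entries has monotone rows: otherwise two
columns could be partially averaged in all rows at no change of the marginals. -/
lemma exists_monotone_mem_sameMarginals [Preorder κ] {a : ι → ℝ} {b : κ → ℝ} (ha : ∀ x, 0 < a x)
    (hb : ∀ y, 0 < b y) {q : ι → κ → ℝ} (hq : ∀ x y, q x y ∈ Set.Icc (0 : ℝ) 1)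
    (hmono : Monotone fun y => ∑ x, a x * q x y) :
    ∃ r ∈ sameMarginals a b q, ∀ x, Monotone (r x) := by
  classical
  obtain ⟨r, ⟨hr, hcol, hrow⟩, hmin⟩ := (isCompact_sameMarginals a b q).exists_isMinOn
    ⟨q, hq, fun _ => rfl, fun _ => rfl⟩
    (f := fun r => ∑ x, a x * ∑ y, b y * r x y ^ 2) (by fun_prop)
  refine ⟨r, ⟨hr, hcol, hrow⟩, fun x₁ y₁ y₂ hy => ?_⟩
  by_contra! hlt
  have hne : y₁ ≠ y₂ := fun h => by simp [h] at hlt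
  obtain ⟨θ, hθ, hθ₁, hθsum⟩ := exists_unitInterval_weights_sum_eq_zero
    (d := fun x => r x y₂ - r x y₁) (fun x => (ha x).le) (by
      simpa only [mul_sub, Finset.sum_sub_distrib, hcol, sub_nonneg] using hmono hy)
  let r' : ι → κ → ℝ := fun x y => r x y + θ x * (r x y₂ - r x y₁) * exchange b y₁ y₂ y
  have hmem : r' ∈ sameMarginals a b q := by
    refine ⟨fun x y => add_mul_exchange_mem_Icc hb hne (hr x) (hθ x) y, fun y => ?_, fun x => ?_⟩
    · simp only [r', mul_add, Finset.sum_add_distrib, ← mul_assoc, ← Finset.sum_mul]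
      simp only [mul_assoc, hθsum, zero_mul, add_zero, hcol]
    · simp only [r', mul_add, Finset.sum_add_distrib, mul_left_comm (b _), ← Finset.mul_sum,
        sum_mul_exchange, mul_zero, add_zero, hrow]
  refine (sum_mul_sum_mul_sq_add_mul_exchange_lt ha hb hne hθ (x₁ := x₁) ?_ hlt.ne).not_ge
    (hmin hmem)
  rw [hθ₁ x₁ (sub_neg.2 hlt)]
  exact zero_lt_one

end SameMarginals

section InformationRents

variable {ι : Type*} [LinearOrder ι] {v q b : ι → ℝ}

/-- A schedule `q` of trade probabilities together with payoffs `b` is incentive compatible for an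
agent with valuations `v` if no type gains from the report of another type. A type `y` that
reports `z` obtains the payoff of `z` and the difference of the two valuations of `q z`. -/
def IncentiveCompatible (v q b : ι → ℝ) : Prop :=
  ∀ y z, b z + (v y - v z) * q z ≤ b y

lemma IncentiveCompatible.monotone (hv : StrictMono v) (h : IncentiveCompatible v q b) :
    Monotone q := by
  refine monotone_iff_forall_lt.2 fun y z hyz => ?_
  have hgap : 0 < v z - v y := sub_pos.2 (hv hyz)
  have hsum : (v z - v y) * q y ≤ (v z - v y) * q z := by linarith [h y z, h z y]
  exact le_of_mul_le_mul_left hsum hgap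

variable [LocallyFiniteOrderBot ι] [SuccOrder ι]

/-- The information rent of type `y`: the part of the payoff of an agent with valuations `v` that
incentive compatibility forces the schedule `q` to leave to type `y`, in excess of the payoff of
the lowest type. It is linear in the schedule. -/
def rent (v : ι → ℝ) : (ι → ℝ) →ₗ[ℝ] (ι → ℝ) where
  toFun q y := ∑ k ∈ Finset.Iio y, (v (Order.succ k) - v k) * q k
  map_add' q r := funext fun y => by
    simp only [Pi.add_apply, mul_add, Finset.sum_add_distrib]
  map_smul' c q := funext fun y => by
    simp only [Pi.smul_apply, smul_eq_mul, RingHom.id_apply, mul_left_comm _ c, Finset.mul_sum]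

lemma rent_apply (v q : ι → ℝ) (y : ι) :
    rent v q y = ∑ k ∈ Finset.Iio y, (v (Order.succ k) - v k) * q k := rfl

lemma rent_nonneg (hv : Monotone v) (hq : ∀ y, 0 ≤ q y) (y : ι) : 0 ≤ rent v q y :=
  Finset.sum_nonneg fun k _ => mul_nonneg (sub_nonneg.2 (hv (Order.le_succ k))) (hq k)

lemma rent_bot [OrderBot ι] (v q : ι → ℝ) : rent v q ⊥ = 0 := by
  simp [rent_apply]

lemma rent_succ (v q : ι → ℝ) (y : ι) :
    rent v q (Order.succ y) = rent v q y + (v (Order.succ y) - v y) * q y := by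
  by_cases hy : IsMax y
  · rw [Order.succ_eq_iff_isMax.2 hy, sub_self, zero_mul, add_zero]
  · rw [rent_apply, Finset.Iio_succ_eq_Iic_of_not_isMax hy, ← Finset.Iio_insert,
      Finset.sum_insert Finset.notMem_Iio_self, add_comm, rent_apply]

variable [IsSuccArchimedean ι]

lemma incentiveCompatible_rent (hv : Monotone v) (hq : Monotone q) :
    IncentiveCompatible v q (rent v q) := by
  intro y z
  rcases le_total z y with hzy | hyz
  · induction hzy using Succ.rec with
    | rfl => rw [sub_self, zero_mul, add_zero]
    | succ y hzy ih =>
      have hstep : (v (Order.succ y) - v y) * q z ≤ (v (Order.succ y) - v y) * q y :=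
        mul_le_mul_of_nonneg_left (hq hzy) (sub_nonneg.2 (hv (Order.le_succ y)))
      rw [rent_succ]
      linarith
  · induction hyz using Succ.rec with
    | rfl => rw [sub_self, zero_mul, add_zero]
    | succ z hyz ih =>
      have hstep : (v (Order.succ z) - v y) * q z ≤ (v (Order.succ z) - v y) * q (Order.succ z) :=
        mul_le_mul_of_nonneg_left (hq (Order.le_succ z))
          (sub_nonneg.2 (hv (hyz.trans (Order.le_succ z))))
      rw [rent_succ]
      linarith

lemma IncentiveCompatible.rent_le [OrderBot ι] (h : IncentiveCompatible v q b)
    (hb : 0 ≤ b ⊥) (y : ι) : rent v q y ≤ b y := by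
  induction bot_le (a := y) using Succ.rec with
  | rfl => rwa [rent_bot]
  | succ y _ ih =>
    rw [rent_succ]
    linarith [h (Order.succ y) y]

end InformationRents

end BilateralTrade

namespace BilateralTrade

namespace Environment

variable {m n : ℕ} (E : Environment m n)

lemma sum_p₁ : ∑ x, E.p₁ x = 1 := E.p₁_mem.2

lemma sum_p₂ : ∑ y, E.p₂ y = 1 := E.p₂_mem.2

include E in
lemma nonempty_seller : Nonempty (Fin m) := by
  by_contra! hempty
  simpa using E.sum_p₁

include E in
lemma nonempty_buyer : Nonempty (Fin n) := by
  by_contra! hempty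
  simpa using E.sum_p₂

/-- The probability of trade that a seller who reports `x` expects. -/
def tradeProb (g : Allocation m n) (x : Fin m) : ℝ :=
  ∑ y, E.p₂ y * g.q x y

/-- The payment that a seller who reports `x` expects, net of the part of her loss from trade that
depends on the buyer's type only. -/
def netRevenue (g : Allocation m n) (x : Fin m) : ℝ :=
  ∑ y, E.p₂ y * (g.t x y - E.v₁₂ y * g.q x y)

/-- The seller's interim payoff from no trade, her outside option. -/
def noTradePayoff (x : Fin m) : ℝ :=
  E.v₁₁ x + ∑ y, E.p₂ y * E.v₁₂ y

variable {E} {g : Allocation m n}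

lemma sellerReport_eq (g : Allocation m n) (xr x : Fin m) :
    E.sellerReport g xr x =
      E.netRevenue g xr - E.v₁₁ x * E.tradeProb g xr + E.noTradePayoff x := by
  have hmean : E.noTradePayoff x = ∑ y, E.p₂ y * (E.v₁₁ x + E.v₁₂ y) := by
    simp only [noTradePayoff, mul_add, Finset.sum_add_distrib, ← Finset.sum_mul, E.sum_p₂, one_mul]
  rw [hmean]
  simp only [sellerReport, netRevenue, tradeProb, sellerPayoff, Finset.mul_sum,
    ← Finset.sum_sub_distrib, ← Finset.sum_add_distrib]
  exact Finset.sum_congr rfl fun y _ => by ring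

end Environment

section RevelationPrinciple

/-- The allocation `g` arises from `G` when the buyer of type `y` accepts with probability `γ y`
and the traders then choose their actions independently according to `σ₁` and `σ₂`. -/
def OutcomeFn.IsInducedBy {m n : ℕ} (g : Allocation m n) (G : Mechanism) (γ : Fin n → ℝ)
    (σ₁ : Fin m → G.S₁ → ℝ) (σ₂ : Fin n → G.S₂ → ℝ) : Prop :=
  (∀ x y, g.q x y = γ y * ∑ s₁, ∑ s₂, σ₁ x s₁ * σ₂ y s₂ * G.out.q s₁ s₂) ∧
    ∀ x y, g.t x y = γ y * ∑ s₁, ∑ s₂, σ₁ x s₁ * σ₂ y s₂ * G.out.t s₁ s₂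

namespace Environment

variable {m n : ℕ} {E : Environment m n} {g : Allocation m n} {π₁ : Fin m → ℝ} {G : Mechanism}
  {γ π₂ : Fin n → ℝ} {σ₁ : Fin m → G.S₁ → ℝ} {σ₂ : Fin n → G.S₂ → ℝ}

lemma buyerReportInterim_of_isInducedBy (h : g.IsInducedBy G γ σ₁ σ₂) (π₁ : Fin m → ℝ)
    (yr y : Fin n) :
    E.buyerReportInterim g π₁ yr y =
      γ yr * ∑ s₂, σ₂ yr s₂ * E.buyerContinuation G π₁ σ₁ y s₂ := by
  have hswap : ∑ s₂, σ₂ yr s₂ * E.buyerContinuation G π₁ σ₁ y s₂ =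
      ∑ x, π₁ x * ∑ s₁, σ₁ x s₁ * ∑ s₂, σ₂ yr s₂ *
        ((E.v₂₁ x + E.v₂₂ y) * G.out.q s₁ s₂ - G.out.t s₁ s₂) := by
    simp only [buyerContinuation, buyerPayoff, Finset.mul_sum]
    rw [Finset.sum_comm]
    refine Finset.sum_congr rfl fun x _ => ?_
    rw [Finset.sum_comm]
    exact Finset.sum_congr rfl fun s₁ _ => Finset.sum_congr rfl fun s₂ _ => by ring
  rw [hswap, buyerReportInterim, Finset.mul_sum]
  refine Finset.sum_congr rfl fun x _ => ?_
  rw [sum_sum_mul_affine, buyerReport, buyerPayoff, h.1, h.2]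
  ring

lemma ConsistentBelief.mul_eq_sum_mul (h : E.ConsistentBelief γ π₂) (y : Fin n) :
    E.p₂ y * γ y = (∑ y', E.p₂ y' * γ y') * π₂ y := by
  obtain ⟨γs, hγs, hγ, hπ⟩ := h
  have := E.nonempty_buyer
  have hbayes : ∀ k, (∑ y', E.p₂ y' * γs k y') * E.acceptPosterior (γs k) y =
      E.p₂ y * γs k y := fun k =>
    mul_div_cancel₀ _ (Finset.sum_pos (fun y' _ => mul_pos (E.p₂_pos y') (hγs k y').1)
      Finset.univ_nonempty).ne'
  refine tendsto_nhds_unique ((hγ y).const_mul (E.p₂ y)) ?_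
  refine Tendsto.congr hbayes ?_
  exact (tendsto_finsetSum _ fun y' _ => (hγ y').const_mul _).mul (hπ y)

lemma sellerReport_of_isInducedBy (h : g.IsInducedBy G γ σ₁ σ₂)
    (hσ₁ : ∀ x, σ₁ x ∈ stdSimplex ℝ G.S₁) (hσ₂ : ∀ y, σ₂ y ∈ stdSimplex ℝ G.S₂)
    (hπ₂ : E.ConsistentBelief γ π₂) (xr x : Fin m) :
    E.sellerReport g xr x =
      (∑ y, E.p₂ y * γ y) * ∑ s₁, σ₁ xr s₁ * E.sellerContinuation G π₂ σ₂ x s₁ +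
        ∑ y, E.p₂ y * (1 - γ y) * (E.v₁₁ x + E.v₁₂ y) := by
  have hswap : ∑ s₁, σ₁ xr s₁ * E.sellerContinuation G π₂ σ₂ x s₁ =
      ∑ y, π₂ y * ∑ s₁, σ₁ xr s₁ * ∑ s₂, σ₂ y s₂ *
        ((E.v₁₁ x + E.v₁₂ y) * (1 - G.out.q s₁ s₂) - -G.out.t s₁ s₂) := by
    simp only [sellerContinuation, sellerPayoff, Finset.mul_sum]
    rw [Finset.sum_comm]
    exact Finset.sum_congr rfl fun y _ => Finset.sum_congr rfl fun s₁ _ =>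
      Finset.sum_congr rfl fun s₂ _ => by ring
  rw [hswap, Finset.mul_sum, sellerReport, ← Finset.sum_add_distrib]
  refine Finset.sum_congr rfl fun y _ => ?_
  have hkeep : ∑ s₁, ∑ s₂, σ₁ xr s₁ * σ₂ y s₂ * (1 - G.out.q s₁ s₂) =
      1 - ∑ s₁, ∑ s₂, σ₁ xr s₁ * σ₂ y s₂ * G.out.q s₁ s₂ := by
    simp only [mul_sub, mul_one, Finset.sum_sub_distrib]
    rw [← Finset.sum_mul_sum, (hσ₁ xr).2, (hσ₂ y).2, one_mul]
  rw [← mul_assoc, ← hπ₂.mul_eq_sum_mul, sum_sum_mul_affine, hkeep, sellerPayoff, h.1, h.2]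
  simp only [mul_neg, Finset.sum_neg_distrib]
  ring

lemma bicBuyer_of_mem_BR (h : g ∈ E.BR π₁ G) : E.BICBuyer π₁ g := by
  obtain ⟨γ, σ₁, σ₂, π₂, hSE, hind⟩ := h
  intro y yr
  calc E.buyerReportInterim g π₁ yr y
      = γ yr * ∑ s₂, σ₂ yr s₂ * E.buyerContinuation G π₁ σ₁ y s₂ :=
        buyerReportInterim_of_isInducedBy hind π₁ yr y
    _ ≤ γ yr * ∑ s₂, σ₂ y s₂ * E.buyerContinuation G π₁ σ₁ y s₂ :=
        mul_le_mul_of_nonneg_left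
          (sum_mul_le_of_mem_stdSimplex (hSE.buyer_mixed yr) (hSE.buyer_optimal y))
          (hSE.accept_mem yr).1
    _ ≤ γ y * ∑ s₂, σ₂ y s₂ * E.buyerContinuation G π₁ σ₁ y s₂ :=
        hSE.accept_optimal y _ (hSE.accept_mem yr)
    _ = E.buyerReportInterim g π₁ y y := (buyerReportInterim_of_isInducedBy hind π₁ y y).symm

lemma iirBuyer_of_mem_BR (h : g ∈ E.BR π₁ G) : E.IIRBuyer π₁ g := by
  obtain ⟨γ, σ₁, σ₂, π₂, hSE, hind⟩ := h
  intro y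
  rw [buyerReportInterim_of_isInducedBy hind]
  simpa only [zero_mul] using hSE.accept_optimal y 0 (Set.left_mem_Icc.2 zero_le_one)

lemma bicSeller_of_mem_BR (h : g ∈ E.BR π₁ G) : E.BICSeller g := by
  obtain ⟨γ, σ₁, σ₂, π₂, hSE, hind⟩ := h
  have hreport := sellerReport_of_isInducedBy hind hSE.seller_mixed hSE.buyer_mixed hSE.consistent
  have hacc : 0 ≤ ∑ y, E.p₂ y * γ y :=
    Finset.sum_nonneg fun y _ => mul_nonneg (E.p₂_pos y).le (hSE.accept_mem y).1
  intro x xr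
  rw [U₁, hreport, hreport]
  exact add_le_add_left (mul_le_mul_of_nonneg_left
    (sum_mul_le_of_mem_stdSimplex (hSE.seller_mixed xr) (hSE.seller_optimal x)) hacc) _

variable (E) in
/-- The mechanism in which the actions of both traders are reports of their types and `g` is
carried out. The environment serves only to exclude empty sets of types. -/
abbrev directMechanism (g : Allocation m n) : Mechanism :=
  { S₁ := Fin m, S₂ := Fin n, nonempty₁ := E.nonempty_seller, nonempty₂ := E.nonempty_buyer,
    out := g }

/-- The action plan of truthful reports. -/
def truthful (k : ℕ) : Fin k → Fin k → ℝ := fun i => Pi.single i 1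

lemma truthful_mem_stdSimplex {k : ℕ} (i : Fin k) : truthful k i ∈ stdSimplex ℝ (Fin k) :=
  single_mem_stdSimplex ℝ i

lemma sum_truthful_mul {k : ℕ} (i : Fin k) (f : Fin k → ℝ) : ∑ j, truthful k i j * f j = f i :=
  single_one_dotProduct i f

lemma sellerContinuation_truthful (g : Allocation m n) (x xr : Fin m) :
    E.sellerContinuation (E.directMechanism g) E.p₂ (truthful n) x xr = E.sellerReport g xr x := by
  simp only [sellerContinuation, sum_truthful_mul, sellerReport]

lemma buyerContinuation_truthful (g : Allocation m n) (π₁ : Fin m → ℝ) (y yr : Fin n) :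
    E.buyerContinuation (E.directMechanism g) π₁ (truthful m) y yr =
      E.buyerReportInterim g π₁ yr y := by
  simp only [buyerContinuation, sum_truthful_mul, buyerReportInterim, buyerReport]

lemma acceptPosterior_const {c : ℝ} (hc : c ≠ 0) (y : Fin n) :
    E.acceptPosterior (fun _ => c) y = E.p₂ y := by
  rw [acceptPosterior, ← Finset.sum_mul, E.sum_p₂, one_mul, mul_div_cancel_right₀ _ hc]

lemma consistentBelief_one : E.ConsistentBelief (fun _ => 1) E.p₂ := by
  obtain ⟨u, -, hu, hlim⟩ := exists_seq_strictMono_tendsto' (zero_lt_one' ℝ)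
  refine ⟨fun k _ => u k, fun k _ => hu k, fun _ => hlim, fun y => ?_⟩
  simp only [acceptPosterior_const (hu _).1.ne', tendsto_const_nhds]

lemma isSequentialEquilibrium_truthful (hs : E.BICSeller g) (hb : E.BICBuyer π₁ g)
    (hi : E.IIRBuyer π₁ g) :
    E.IsSequentialEquilibrium π₁ (E.directMechanism g) (fun _ => 1) (truthful m) (truthful n)
      E.p₂ where
  accept_mem _ := Set.right_mem_Icc.2 zero_le_one
  seller_mixed := truthful_mem_stdSimplex
  buyer_mixed := truthful_mem_stdSimplex
  consistent := consistentBelief_one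
  seller_optimal x xr := by
    simp only [sellerContinuation_truthful, sum_truthful_mul]
    exact hs x xr
  buyer_optimal y yr := by
    simp only [buyerContinuation_truthful, sum_truthful_mul]
    exact hb y yr
  accept_optimal y a ha := by
    simp only [buyerContinuation_truthful, sum_truthful_mul]
    exact mul_le_mul_of_nonneg_right ha.2 (hi y)

lemma isInducedBy_truthful (g : Allocation m n) :
    g.IsInducedBy (E.directMechanism g) (fun _ => 1) (truthful m) (truthful n) := by
  simp only [OutcomeFn.IsInducedBy, mul_assoc, ← Finset.mul_sum, sum_truthful_mul, one_mul,
    implies_true, and_self]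

theorem exists_mem_BR_iff :
    (∃ G, g ∈ E.BR π₁ G) ↔ E.BICSeller g ∧ E.BICBuyer π₁ g ∧ E.IIRBuyer π₁ g :=
  ⟨fun ⟨_, hG⟩ => ⟨bicSeller_of_mem_BR hG, bicBuyer_of_mem_BR hG, iirBuyer_of_mem_BR hG⟩,
    fun ⟨hs, hb, hi⟩ => ⟨E.directMechanism g, _, _, _, _,
      isSequentialEquilibrium_truthful hs hb hi, isInducedBy_truthful g⟩⟩

end Environment

end RevelationPrinciple

end BilateralTrade

namespace BilateralTrade

section Mixtures

/-- The lottery over two outcome functions that carries out `g'` with probability `α a` and `g`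
otherwise, where `a` is the first argument. -/
def OutcomeFn.mixture {A B : Type} (α : A → ℝ) (hα : ∀ a, α a ∈ Set.Icc (0 : ℝ) 1)
    (g' g : OutcomeFn A B) : OutcomeFn A B where
  q a b := α a * g'.q a b + (1 - α a) * g.q a b
  t a b := α a * g'.t a b + (1 - α a) * g.t a b
  q_mem a b := convex_Icc (0 : ℝ) 1 (g'.q_mem a b) (g.q_mem a b) (hα a).1
    (sub_nonneg.2 (hα a).2) (add_sub_cancel _ _)

namespace Environment

open OutcomeFn

variable {m n : ℕ} {E : Environment m n} {g g' : Allocation m n} {π₁ : Fin m → ℝ}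

lemma BICBuyer.smul (h : E.BICBuyer π₁ g) {c : ℝ} (hc : 0 ≤ c) : E.BICBuyer (c • π₁) g := by
  intro y yr
  simp only [buyerReportInterim, Pi.smul_apply, smul_eq_mul, mul_assoc, ← Finset.mul_sum]
  exact mul_le_mul_of_nonneg_left (h y yr) hc

lemma IIRBuyer.smul (h : E.IIRBuyer π₁ g) {c : ℝ} (hc : 0 ≤ c) : E.IIRBuyer (c • π₁) g := by
  intro y
  simp only [buyerReportInterim, Pi.smul_apply, smul_eq_mul, mul_assoc, ← Finset.mul_sum]
  exact mul_nonneg hc (h y)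

lemma RSWConstraints.bicBuyer (h : E.RSWConstraints g) (hπ : 0 ≤ π₁) : E.BICBuyer π₁ g :=
  fun y yr => Finset.sum_le_sum fun x _ => mul_le_mul_of_nonneg_left (h.2.1 x y yr) (hπ x)

lemma RSWConstraints.iirBuyer (h : E.RSWConstraints g) (hπ : 0 ≤ π₁) : E.IIRBuyer π₁ g :=
  fun y => Finset.sum_nonneg fun x _ => mul_nonneg (hπ x) (h.2.2 x y)

variable {α : Fin m → ℝ} {hα : ∀ x, α x ∈ Set.Icc (0 : ℝ) 1}

lemma sellerReport_mixture (xr x : Fin m) :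
    E.sellerReport (mixture α hα g' g) xr x =
      α xr * E.sellerReport g' xr x + (1 - α xr) * E.sellerReport g xr x := by
  simp only [sellerReport, sellerPayoff, mixture, Finset.mul_sum, ← Finset.sum_add_distrib]
  exact Finset.sum_congr rfl fun y _ => by ring

lemma buyerReportInterim_mixture (yr y : Fin n) :
    E.buyerReportInterim (mixture α hα g' g) π₁ yr y =
      E.buyerReportInterim g' (π₁ * α) yr y + E.buyerReportInterim g (π₁ * (1 - α)) yr y := by
  simp only [buyerReportInterim, buyerReport, buyerPayoff, mixture, Pi.mul_apply, Pi.sub_apply,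
    Pi.one_apply, ← Finset.sum_add_distrib]
  exact Finset.sum_congr rfl fun x _ => by ring

lemma BICBuyer.mixture (h' : E.BICBuyer (π₁ * α) g') (h : E.BICBuyer (π₁ * (1 - α)) g) :
    E.BICBuyer π₁ (mixture α hα g' g) := fun y yr => by
  simp only [buyerReportInterim_mixture]
  exact add_le_add (h' y yr) (h y yr)

lemma IIRBuyer.mixture (h' : E.IIRBuyer (π₁ * α) g') (h : E.IIRBuyer (π₁ * (1 - α)) g) :
    E.IIRBuyer π₁ (mixture α hα g' g) := fun y => by
  simp only [buyerReportInterim_mixture]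
  exact add_nonneg (h' y) (h y)

lemma U₁_mixture_eq_max (hgain : ∀ x, E.U₁ g x < E.U₁ g' x → α x = 1)
    (hloss : ∀ x, E.U₁ g' x < E.U₁ g x → α x = 0) (x : Fin m) :
    E.U₁ (mixture α hα g' g) x = max (E.U₁ g' x) (E.U₁ g x) := by
  rw [U₁, sellerReport_mixture]
  change α x * E.U₁ g' x + (1 - α x) * E.U₁ g x = _
  rcases lt_trichotomy (E.U₁ g x) (E.U₁ g' x) with hlt | heq | hgt
  · rw [hgain x hlt, max_eq_left hlt.le, one_mul, sub_self, zero_mul, add_zero]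
  · rw [heq, max_self, ← add_mul, add_sub_cancel, one_mul]
  · rw [hloss x hgt, max_eq_right hgt.le, zero_mul, zero_add, sub_zero, one_mul]

lemma BICSeller.mixture (h' : E.BICSeller g') (h : E.BICSeller g)
    (hmax : ∀ x, E.U₁ (mixture α hα g' g) x = max (E.U₁ g' x) (E.U₁ g x)) :
    E.BICSeller (mixture α hα g' g) := by
  intro x xr
  rw [hmax, sellerReport_mixture]
  have hle' : E.sellerReport g' xr x ≤ max (E.U₁ g' x) (E.U₁ g x) := le_max_of_le_left (h' x xr)
  have hle : E.sellerReport g xr x ≤ max (E.U₁ g' x) (E.U₁ g x) := le_max_of_le_right (h x xr)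
  exact convex_Iic (max (E.U₁ g' x) (E.U₁ g x)) hle' hle (hα xr).1 (sub_nonneg.2 (hα xr).2)
    (add_sub_cancel _ _)

/-- By Bayes' rule, the buyer holds the credible belief `π₁` if he learns that the seller deviated
and type `x` deviates with probability `α x`. -/
lemma exists_deviationProb_of_mem_credibleBeliefs (hπ₁ : π₁ ∈ E.credibleBeliefs g g')
    (hgain : ∃ x, E.U₁ g x < E.U₁ g' x) :
    ∃ (α : Fin m → ℝ) (c : ℝ), (∀ x, α x ∈ Set.Icc (0 : ℝ) 1) ∧ 0 ≤ c ∧ E.p₁ * α = c • π₁ ∧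
      (∀ x, E.U₁ g x < E.U₁ g' x → α x = 1) ∧ ∀ x, E.U₁ g' x < E.U₁ g x → α x = 0 := by
  obtain ⟨hsimplex, hsupp, hratio⟩ := hπ₁
  obtain ⟨x₀, hx₀⟩ := hgain
  set ρ : Fin m → ℝ := fun x => π₁ x / E.p₁ x with hρ
  have hmul : ∀ x, E.p₁ x * ρ x = π₁ x := fun x => mul_div_cancel₀ _ (E.p₁_pos x).ne'
  have hρ₀ : 0 < ρ x₀ := zero_lt_one.trans_le <| calc
    1 = ∑ x, E.p₁ x * ρ x := by simp only [hmul, hsimplex.2]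
    _ ≤ ρ x₀ := sum_mul_le_of_mem_stdSimplex E.p₁_mem fun x => hratio x x₀ hx₀
  refine ⟨fun x => ρ x / ρ x₀, (ρ x₀)⁻¹, fun x => ⟨?_, ?_⟩, (inv_pos.2 hρ₀).le, ?_,
    fun x hx => ?_, fun x hx => ?_⟩
  · exact div_nonneg (div_nonneg (hsimplex.1 x) (E.p₁_pos x).le) hρ₀.le
  · exact (div_le_one hρ₀).2 (hratio x x₀ hx₀)
  · ext x
    rw [Pi.mul_apply, Pi.smul_apply, smul_eq_mul, ← hmul x]
    ring
  · exact (div_eq_one_iff_eq hρ₀.ne').2 ((hratio x x₀ hx₀).antisymm (hratio x₀ x hx))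
  · simp only [hρ, hsupp x fun h => h.elim hx.not_gt hx.ne, zero_div]

theorem RSWConstraints.passesFGP_of_undominated (hg : E.RSWConstraints g)
    (hundom : E.Undominated g) : E.PassesFGP g := by
  refine ⟨hundom.1, ?_⟩
  rintro ⟨g', ⟨x₀, hx₀⟩, G, π₁, hπ₁, hBR⟩
  obtain ⟨hs, hb, hi⟩ := exists_mem_BR_iff.1 ⟨G, hBR⟩
  obtain ⟨α, c, hα, hc, hbayes, hgain, hloss⟩ :=
    exists_deviationProb_of_mem_credibleBeliefs hπ₁ ⟨x₀, hx₀⟩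
  have hmax := U₁_mixture_eq_max (hα := hα) hgain hloss
  have hstay : 0 ≤ E.p₁ * (1 - α) := fun x =>
    mul_nonneg (E.p₁_pos x).le (sub_nonneg.2 (hα x).2)
  refine hundom.2 ⟨mixture α hα g' g, ⟨hs.mixture hg.1 hmax, fun x => ?_, ?_, ?_⟩,
    fun x => hmax x ▸ le_max_right _ _, x₀, hmax x₀ ▸ lt_max_of_lt_left hx₀⟩
  · exact (hundom.1.2.1 x).trans (hmax x ▸ le_max_right _ _)
  · exact (hbayes ▸ hb.smul hc).mixture (hg.bicBuyer hstay)
  · exact (hbayes ▸ hi.smul hc).mixture (hg.iirBuyer hstay)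

end Environment

end Mixtures

end BilateralTrade

namespace BilateralTrade

namespace Environment

variable {m n : ℕ} {E : Environment m n} {g g' : Allocation m n} {π₁ : Fin m → ℝ}

section CredibleDeviations

variable {Z : Finset (Fin m)}

variable (E) in
/-- The prior conditional on the event `Z`: the belief of a buyer who expects a deviation from
exactly the types in `Z`. -/
noncomputable def condPrior (Z : Finset (Fin m)) (x : Fin m) : ℝ :=
  if x ∈ Z then E.p₁ x / ∑ z ∈ Z, E.p₁ z else 0

lemma condPrior_of_mem {x : Fin m} (hx : x ∈ Z) : E.condPrior Z x = E.p₁ x / ∑ z ∈ Z, E.p₁ z :=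
  if_pos hx

lemma condPrior_of_notMem {x : Fin m} (hx : x ∉ Z) : E.condPrior Z x = 0 := if_neg hx

lemma condPrior_univ : E.condPrior Finset.univ = E.p₁ := by
  ext x
  rw [condPrior_of_mem (Finset.mem_univ x), E.sum_p₁, div_one]

lemma condPrior_mem_stdSimplex (hZ : Z.Nonempty) : E.condPrior Z ∈ stdSimplex ℝ (Fin m) := by
  have hpos : 0 < ∑ z ∈ Z, E.p₁ z := Finset.sum_pos (fun z _ => E.p₁_pos z) hZ
  refine ⟨fun x => ?_, ?_⟩
  · unfold condPrior
    split_ifs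
    · exact div_nonneg (E.p₁_pos x).le hpos.le
    · exact le_rfl
  · simp only [condPrior, Finset.sum_ite_mem, Finset.univ_inter, ← Finset.sum_div]
    exact div_self hpos.ne'

lemma le_sum_condPrior_mul (hZ : Z.Nonempty) {f : Fin m → ℝ} {c : ℝ} (hf : ∀ x ∈ Z, c ≤ f x) :
    c ≤ ∑ x, E.condPrior Z x * f x := by
  have hcond := condPrior_mem_stdSimplex (E := E) hZ
  calc c = ∑ x, E.condPrior Z x * c := by rw [← Finset.sum_mul, hcond.2, one_mul]
    _ ≤ ∑ x, E.condPrior Z x * f x := Finset.sum_le_sum fun x _ => by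
      by_cases hx : x ∈ Z
      · exact mul_le_mul_of_nonneg_left (hf x hx) (hcond.1 x)
      · rw [condPrior_of_notMem hx, zero_mul, zero_mul]

lemma condPrior_mem_credibleBeliefs (hZ : Z.Nonempty) (hmem : ∀ x, E.U₁ g x < E.U₁ g' x → x ∈ Z)
    (hle : ∀ x ∈ Z, E.U₁ g x ≤ E.U₁ g' x) : E.condPrior Z ∈ E.credibleBeliefs g g' := by
  have hratio : ∀ x ∈ Z, E.condPrior Z x / E.p₁ x = (∑ z ∈ Z, E.p₁ z)⁻¹ := fun x hx => by
    rw [condPrior_of_mem hx, div_div_cancel_left' (E.p₁_pos x).ne']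
  refine ⟨condPrior_mem_stdSimplex hZ, fun x hx => condPrior_of_notMem fun hxZ => ?_,
    fun x x' hx' => ?_⟩
  · exact hx ((hle x hxZ).lt_or_eq.imp_right Eq.symm)
  · rw [hratio x' (hmem x' hx')]
    by_cases hxZ : x ∈ Z
    · exact (hratio x hxZ).le
    · rw [condPrior_of_notMem hxZ, zero_div]
      exact inv_nonneg.2 (Finset.sum_nonneg fun z _ => (E.p₁_pos z).le)

lemma PassesFGP.le_of_mem_credibleBeliefs (hg : E.PassesFGP g) (hπ₁ : π₁ ∈ E.credibleBeliefs g g')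
    (hs : E.BICSeller g') (hb : E.BICBuyer π₁ g') (hi : E.IIRBuyer π₁ g') (x : Fin m) :
    E.U₁ g' x ≤ E.U₁ g x := by
  by_contra! hx
  obtain ⟨G, hG⟩ := exists_mem_BR_iff.2 ⟨hs, hb, hi⟩
  exact hg.2 ⟨g', ⟨x, hx⟩, G, π₁, hπ₁, hG⟩

lemma PassesFGP.undominated (hg : E.PassesFGP g) : E.Undominated g := by
  refine ⟨hg.1, ?_⟩
  rintro ⟨g', ⟨hs, -, hb, hi⟩, hle, x, hx⟩
  have hcred : E.p₁ ∈ E.credibleBeliefs g g' := condPrior_univ (E := E) ▸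
    condPrior_mem_credibleBeliefs ⟨x, Finset.mem_univ x⟩ (fun z _ => Finset.mem_univ z)
      fun z _ => hle z
  exact hx.not_ge (hg.le_of_mem_credibleBeliefs hcred hs hb hi x)

lemma PassesFGP.le_of_rswConstraints (hg : E.PassesFGP g) (hg' : E.RSWConstraints g')
    (x : Fin m) : E.U₁ g' x ≤ E.U₁ g x := by
  classical
  by_contra! hx
  obtain ⟨Z, hmem⟩ : ∃ Z : Finset (Fin m), ∀ z, z ∈ Z ↔ E.U₁ g z < E.U₁ g' z :=
    ⟨Finset.univ.filter _, Finset.mem_filter_univ⟩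
  have hne : Z.Nonempty := ⟨x, (hmem x).2 hx⟩
  have hcred : E.condPrior Z ∈ E.credibleBeliefs g g' :=
    condPrior_mem_credibleBeliefs hne (fun z => (hmem z).2) fun z hz => ((hmem z).1 hz).le
  exact hx.not_ge (hg.le_of_mem_credibleBeliefs hcred hg'.1 (hg'.bicBuyer hcred.1.1)
    (hg'.iirBuyer hcred.1.1) x)

end CredibleDeviations

section RentAllocations

lemma bicBuyer_iff : E.BICBuyer π₁ g ↔ IncentiveCompatible E.v₂₂
    (fun y => ∑ x, π₁ x * g.q x y) (fun y => E.buyerReportInterim g π₁ y y) := by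
  refine forall₂_congr fun y z => ?_
  suffices h : E.buyerReportInterim g π₁ z z + (E.v₂₂ y - E.v₂₂ z) * ∑ x, π₁ x * g.q x z =
      E.buyerReportInterim g π₁ z y by rw [h]
  simp only [buyerReportInterim, buyerReport, buyerPayoff, Finset.mul_sum,
    ← Finset.sum_add_distrib]
  exact Finset.sum_congr rfl fun x _ => by ring

lemma sum_netRevenue_add_sum_buyerReportInterim (g : Allocation m n) (π₁ : Fin m → ℝ) :
    ∑ x, π₁ x * E.netRevenue g x + ∑ y, E.p₂ y * E.buyerReportInterim g π₁ y y =
      ∑ x, π₁ x * (E.v₂₁ x * E.tradeProb g x) +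
        ∑ y, E.p₂ y * ((E.v₂₂ y - E.v₁₂ y) * ∑ x, π₁ x * g.q x y) := by
  have hbuyer : ∑ y, E.p₂ y * E.buyerReportInterim g π₁ y y =
      ∑ x, ∑ y, E.p₂ y * (π₁ x * E.buyerReport g y x y) := by
    simp only [buyerReportInterim, Finset.mul_sum]
    exact Finset.sum_comm
  have hgains : ∑ y, E.p₂ y * ((E.v₂₂ y - E.v₁₂ y) * ∑ x, π₁ x * g.q x y) =
      ∑ x, ∑ y, E.p₂ y * ((E.v₂₂ y - E.v₁₂ y) * (π₁ x * g.q x y)) := by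
    simp only [Finset.mul_sum]
    exact Finset.sum_comm
  rw [hbuyer, hgains]
  simp only [netRevenue, tradeProb, buyerReport, buyerPayoff, Finset.mul_sum,
    ← Finset.sum_add_distrib]
  exact Finset.sum_congr rfl fun x _ => Finset.sum_congr rfl fun y _ => by ring

variable (E) in
/-- The virtual surplus of a schedule `s`, without the term that depends on the seller's type: the
expected revenue, net of her loss from trade, of a seller who leaves the buyer his information rent
only. -/
def virtualSurplus : (Fin n → ℝ) →ₗ[ℝ] ℝ where
  toFun s := ∑ y, E.p₂ y * ((E.v₂₂ y - E.v₁₂ y) * s y - rent E.v₂₂ s y)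
  map_add' s s' := by
    simp only [map_add, Pi.add_apply, ← Finset.sum_add_distrib]
    exact Finset.sum_congr rfl fun y _ => by ring
  map_smul' c s := by
    simp only [map_smul, Pi.smul_apply, smul_eq_mul, RingHom.id_apply, Finset.mul_sum]
    exact Finset.sum_congr rfl fun y _ => by ring

lemma virtualSurplus_apply (s : Fin n → ℝ) :
    E.virtualSurplus s = ∑ y, E.p₂ y * ((E.v₂₂ y - E.v₁₂ y) * s y - rent E.v₂₂ s y) := rfl

lemma sum_mul_netRevenue_le (hb : E.BICBuyer π₁ g) (hi : E.IIRBuyer π₁ g) :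
    ∑ x, π₁ x * E.netRevenue g x ≤
      ∑ x, π₁ x * (E.v₂₁ x * E.tradeProb g x) +
        E.virtualSurplus fun y => ∑ x, π₁ x * g.q x y := by
  have := E.nonempty_buyer
  have : NeZero n := NeZero.of_pos (Fin.pos_iff_nonempty.2 this)
  have hrent : ∑ y, E.p₂ y * rent E.v₂₂ (fun y => ∑ x, π₁ x * g.q x y) y ≤
      ∑ y, E.p₂ y * E.buyerReportInterim g π₁ y y := Finset.sum_le_sum fun y _ =>
    mul_le_mul_of_nonneg_left ((bicBuyer_iff.1 hb).rent_le (hi ⊥) y) (E.p₂_pos y).le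
  simp only [virtualSurplus_apply, mul_sub (E.p₂ _), Finset.sum_sub_distrib]
  linarith [sum_netRevenue_add_sum_buyerReportInterim (E := E) g π₁]

variable (E) in
/-- The allocation with trade probabilities `r` in which a buyer of type `y`, if he attaches the
value `w x + E.v₂₂ y` to the good, obtains his information rent and the constant `b`. The seller's
report `x` determines `w x`, which need not be the value `E.v₂₁ x` that the buyer derives from her
type. -/
def rentAllocation (r : Fin m → Fin n → ℝ) (hr : ∀ x y, r x y ∈ Set.Icc (0 : ℝ) 1)
    (w : Fin m → ℝ) (b : ℝ) : Allocation m n where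
  q := r
  t x y := (w x + E.v₂₂ y) * r x y - rent E.v₂₂ (r x) y - b
  q_mem := hr

variable {r : Fin m → Fin n → ℝ} {hr : ∀ x y, r x y ∈ Set.Icc (0 : ℝ) 1} {w : Fin m → ℝ} {b : ℝ}

lemma netRevenue_rentAllocation (x : Fin m) :
    E.netRevenue (E.rentAllocation r hr w b) x =
      w x * E.tradeProb (E.rentAllocation r hr w b) x + E.virtualSurplus (r x) - b := by
  have hmean : ∑ y, E.p₂ y * b = b := by rw [← Finset.sum_mul, E.sum_p₂, one_mul]
  refine Eq.trans ?_ (congrArg (_ - ·) hmean)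
  simp only [netRevenue, tradeProb, virtualSurplus_apply, rentAllocation, Finset.mul_sum,
    ← Finset.sum_add_distrib, ← Finset.sum_sub_distrib]
  exact Finset.sum_congr rfl fun y _ => by ring

lemma buyerReport_rentAllocation (yr : Fin n) (x : Fin m) (y : Fin n) :
    E.buyerReport (E.rentAllocation r hr w b) yr x y =
      (E.v₂₁ x - w x) * r x yr + (rent E.v₂₂ (r x) yr + (E.v₂₂ y - E.v₂₂ yr) * r x yr + b) := by
  simp only [buyerReport, buyerPayoff, rentAllocation]
  ring

lemma rswConstraints_rentAllocation (hmono : ∀ x, Monotone (r x)) (hb : 0 ≤ b)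
    (hs : E.BICSeller (E.rentAllocation r hr E.v₂₁ b)) :
    E.RSWConstraints (E.rentAllocation r hr E.v₂₁ b) := by
  refine ⟨hs, fun x y yr => ?_, fun x y => ?_⟩ <;> rw [buyerReport_rentAllocation]
  · rw [buyerReport_rentAllocation]
    linarith [incentiveCompatible_rent E.v₂₂_strictMono.monotone (hmono x) y yr]
  · linarith [rent_nonneg E.v₂₂_strictMono.monotone (fun y => (hr x y).1) y]

lemma buyerReportInterim_rentAllocation_const (hπ₁ : π₁ ∈ stdSimplex ℝ (Fin m)) {s : Fin n → ℝ}
    (hs : ∀ y, s y ∈ Set.Icc (0 : ℝ) 1) (yr y : Fin n) :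
    E.buyerReportInterim (E.rentAllocation (fun _ => s) (fun _ => hs)
        (fun _ => ∑ z, π₁ z * E.v₂₁ z) b) π₁ yr y =
      rent E.v₂₂ s yr + (E.v₂₂ y - E.v₂₂ yr) * s yr + b := by
  simp only [buyerReportInterim, buyerReport_rentAllocation, mul_add (π₁ _), sub_mul, mul_sub,
    Finset.sum_add_distrib, Finset.sum_sub_distrib, ← mul_assoc, ← Finset.sum_mul, hπ₁.2]
  ring

/-- The seller can be paid `R` for a monotone schedule without disclosing her type: the buyer then
only cares about his expectation of `E.v₂₁`, and he obtains all of the surplus in excess of `R`. -/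
lemma exists_pooling_allocation (hπ₁ : π₁ ∈ stdSimplex ℝ (Fin m)) {s : Fin n → ℝ}
    (hs : ∀ y, s y ∈ Set.Icc (0 : ℝ) 1) (hmono : Monotone s) {R : ℝ}
    (hR : R ≤ (∑ x, π₁ x * E.v₂₁ x) * ∑ y, E.p₂ y * s y + E.virtualSurplus s) :
    ∃ g : Allocation m n, E.BICSeller g ∧ E.BICBuyer π₁ g ∧ E.IIRBuyer π₁ g ∧
      ∀ x, E.U₁ g x = R - E.v₁₁ x * ∑ y, E.p₂ y * s y + E.noTradePayoff x := by
  set b := (∑ x, π₁ x * E.v₂₁ x) * ∑ y, E.p₂ y * s y + E.virtualSurplus s - R with hb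
  refine ⟨E.rentAllocation (fun _ => s) (fun _ => hs) (fun _ => ∑ z, π₁ z * E.v₂₁ z) b,
    fun x xr => le_rfl, fun y yr => ?_, fun y => ?_, fun x => ?_⟩
  · simp only [buyerReportInterim_rentAllocation_const hπ₁ hs]
    linarith [incentiveCompatible_rent E.v₂₂_strictMono.monotone hmono y yr]
  · rw [buyerReportInterim_rentAllocation_const hπ₁ hs]
    linarith [rent_nonneg E.v₂₂_strictMono.monotone (fun y => (hs y).1) y]
  · rw [U₁, sellerReport_eq, netRevenue_rentAllocation, hb, tradeProb]
    simp only [rentAllocation]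
    ring

end RentAllocations

end Environment

end BilateralTrade

namespace BilateralTrade

namespace Environment

section NoCrossSubsidies

variable {m n : ℕ} {E : Environment m n} {g h : Allocation m n}

/-- The price `c` per unit of forgone trade separates `x'` from the types below her, so that less
trade is attractive to `x'` and the types above. Of these, a small change attracts only those who
are indifferent to the report `x'`. -/
lemma BICSeller.exists_finset_lt_sellerReport_add_iff (hg : E.BICSeller g) {x' : Fin m}
    (htrade : 0 < E.tradeProb g x') :
    ∃ (Z : Finset (Fin m)) (c : ℝ), x' ∈ Z ∧ (∀ x ∈ Z, x' ≤ x) ∧ ∀ᶠ ε : ℝ in 𝓝[>] 0, ∀ x,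
      E.U₁ g x < E.sellerReport g x' x + ε * (E.tradeProb g x' * (E.v₁₁ x - c)) ↔ x ∈ Z := by
  classical
  obtain ⟨c, hc⟩ := exists_lt_apply_iff_le E.v₁₁_strictMono x'
  obtain ⟨Z, hmem⟩ : ∃ Z : Finset (Fin m), ∀ x,
      x ∈ Z ↔ E.sellerReport g x' x = E.U₁ g x ∧ x' ≤ x :=
    ⟨Finset.univ.filter _, Finset.mem_filter_univ⟩
  refine ⟨Z, c, (hmem x').2 ⟨rfl, le_rfl⟩, fun x hx => ((hmem x).1 hx).2, ?_⟩
  filter_upwards [eventually_lt_add_mul_iff (fun x => hg x x')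
    fun x => E.tradeProb g x' * (E.v₁₁ x - c)] with ε hε x
  rw [hε, hmem, mul_pos_iff_of_pos_left htrade, sub_pos, hc]

lemma PassesFGP.lt_of_forall_lt_iff_mem (hg : E.PassesFGP g) {Z : Finset (Fin m)} (hZ : Z.Nonempty)
    {s : Fin n → ℝ} (hs : ∀ y, s y ∈ Set.Icc (0 : ℝ) 1) (hmono : Monotone s) {R : ℝ}
    (hgain : ∀ x, E.U₁ g x < R - E.v₁₁ x * ∑ y, E.p₂ y * s y + E.noTradePayoff x ↔ x ∈ Z) :
    (∑ x, E.condPrior Z x * E.v₂₁ x) * ∑ y, E.p₂ y * s y + E.virtualSurplus s < R := by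
  by_contra! hR
  obtain ⟨g', hBIC, hBIC', hIIR', hU⟩ :=
    exists_pooling_allocation (condPrior_mem_stdSimplex hZ) hs hmono hR
  simp only [← hU] at hgain
  have hcred : E.condPrior Z ∈ E.credibleBeliefs g g' :=
    condPrior_mem_credibleBeliefs hZ (fun x => (hgain x).1) fun x hx => ((hgain x).2 hx).le
  obtain ⟨x, hx⟩ := hZ
  exact ((hgain x).2 hx).not_ge (hg.le_of_mem_credibleBeliefs hcred hBIC hBIC' hIIR' x)

theorem PassesFGP.virtualSurplus_le_netRevenue (hg : E.PassesFGP g) {s : Fin n → ℝ}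
    (hs : ∀ y, s y ∈ Set.Icc (0 : ℝ) 1) (hmono : Monotone s) {x' : Fin m}
    (hprob : ∑ y, E.p₂ y * s y = E.tradeProb g x') :
    E.v₂₁ x' * E.tradeProb g x' + E.virtualSurplus s ≤ E.netRevenue g x' := by
  have hQ₀ : 0 ≤ E.tradeProb g x' :=
    Finset.sum_nonneg fun y _ => mul_nonneg (E.p₂_pos y).le (g.q_mem x' y).1
  rcases hQ₀.eq_or_lt with hQ | hQ
  · have hs₀ : s = 0 := funext <|
      (sum_mul_eq_zero_iff_of_pos E.p₂_pos fun y => (hs y).1).1 (hprob.trans hQ.symm)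
    have hIR : E.noTradePayoff x' ≤ E.sellerReport g x' x' := hg.1.2.1 x'
    rw [sellerReport_eq, ← hQ] at hIR
    rw [← hQ, hs₀, map_zero]
    linarith
  by_contra! hlt
  obtain ⟨Z, c, hx', hZ, hgain⟩ := hg.1.1.exists_finset_lt_sellerReport_add_iff hQ
  set Q := E.tradeProb g x' with hQ_def
  set W := ∑ x, E.condPrior Z x * E.v₂₁ x
  have hW : E.v₂₁ x' ≤ W := le_sum_condPrior_mul ⟨x', hx'⟩ fun x hx => E.v₂₁_mono (hZ x hx)
  have hslack : ∀ᶠ ε : ℝ in 𝓝[>] 0,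
      E.netRevenue g x' - ε * (Q * c) < (1 - ε) * (W * Q + E.virtualSurplus s) := by
    refine nhdsWithin_le_nhds (ContinuousAt.eventually_lt (by fun_prop) (by fun_prop) ?_)
    simp only [zero_mul, sub_zero, one_mul]
    linarith [mul_le_mul_of_nonneg_right hW hQ₀]
  obtain ⟨ε, hgain, hslack, hε₀, hε₁⟩ := (hgain.and (hslack.and
    (Ioo_mem_nhdsGT (zero_lt_one' ℝ)))).exists
  have hε : 1 - ε ∈ Set.Icc (0 : ℝ) 1 := ⟨by linarith, by linarith⟩
  have hprob' : ∑ y, E.p₂ y * ((1 - ε) • s) y = (1 - ε) * Q := by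
    simp only [← hprob, Finset.mul_sum, Pi.smul_apply, smul_eq_mul, mul_left_comm]
  have hafford := hg.lt_of_forall_lt_iff_mem ⟨x', hx'⟩ (s := (1 - ε) • s)
    (R := E.netRevenue g x' - ε * (Q * c)) (fun y => unitInterval.mul_mem hε (hs y))
    (hmono.const_smul hε.1) fun x => by
      rw [← hgain, hprob', sellerReport_eq, ← hQ_def]
      ring_nf
  rw [hprob', map_smul, smul_eq_mul] at hafford
  linarith

theorem PassesFGP.exists_isRSW (hg : E.PassesFGP g) :
    ∃ g', E.IsRSW g' ∧ ∀ x, E.U₁ g' x = E.U₁ g x := by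
  obtain ⟨r, ⟨hr, hcol, hrow⟩, hmono⟩ := exists_monotone_mem_sameMarginals E.p₁_pos E.p₂_pos
    g.q_mem ((bicBuyer_iff.1 hg.1.2.2.1).monotone E.v₂₂_strictMono)
  set δ : Fin m → ℝ := fun x =>
    E.netRevenue g x - (E.v₂₁ x * E.tradeProb g x + E.virtualSurplus (r x)) with hδ
  have hδ₀ : ∀ x, 0 ≤ δ x := fun x =>
    sub_nonneg.2 (hg.virtualSurplus_le_netRevenue (hr x) (hmono x) (hrow x))
  have hmean : (fun y => ∑ x, E.p₁ x * g.q x y) = ∑ x, E.p₁ x • r x := by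
    ext y
    simp only [Finset.sum_apply, Pi.smul_apply, smul_eq_mul, hcol]
  have hsum : ∑ x, E.p₁ x * δ x ≤ 0 := by
    have htotal := sum_mul_netRevenue_le hg.1.2.2.1 hg.1.2.2.2
    simp only [hmean, map_sum, map_smul, smul_eq_mul] at htotal
    simp only [hδ, mul_sub, mul_add, Finset.sum_sub_distrib, Finset.sum_add_distrib]
    linarith
  have hzero : ∀ x, δ x = 0 := (sum_mul_eq_zero_iff_of_pos E.p₁_pos hδ₀).1
    (hsum.antisymm (Finset.sum_nonneg fun x _ => mul_nonneg (E.p₁_pos x).le (hδ₀ x)))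
  set g' := E.rentAllocation r hr E.v₂₁ 0 with hg'
  have htrade : ∀ x, E.tradeProb g' x = E.tradeProb g x := hrow
  have hreport : ∀ xr x, E.sellerReport g' xr x = E.sellerReport g xr x := fun xr x => by
    rw [sellerReport_eq, sellerReport_eq, htrade, hg', netRevenue_rentAllocation, ← hg', htrade]
    linarith [hzero xr]
  have hBIC : E.BICSeller g' := fun x xr => by
    rw [U₁, hreport, hreport]
    exact hg.1.1 x xr
  refine ⟨g', ⟨rswConstraints_rentAllocation hmono le_rfl hBIC, fun x k hk => ?_⟩,
    fun x => hreport x x⟩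
  exact (hg.le_of_rswConstraints hk x).trans_eq (hreport x x).symm

theorem PassesFGP.undominated_of_isRSW (hg : E.PassesFGP g) (hh : E.IsRSW h) :
    E.Undominated h := by
  obtain ⟨g', hg', hU⟩ := hg.exists_isRSW
  have hle : ∀ x, E.U₁ g x ≤ E.U₁ h x := fun x => hU x ▸ hh.2 x g' hg'.1
  have hprior : 0 ≤ E.p₁ := fun x => (E.p₁_pos x).le
  refine ⟨⟨hh.1.1, fun x => (hg.1.2.1 x).trans (hle x), hh.1.bicBuyer hprior,
    hh.1.iirBuyer hprior⟩, ?_⟩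
  rintro ⟨k, hk, hdom, x, hx⟩
  exact hg.undominated.2 ⟨k, hk, fun z => (hle z).trans (hdom z), x, (hle x).trans_lt hx⟩

end NoCrossSubsidies

end Environment

end BilateralTrade

theorem proposition6 {m n : ℕ} (E : BilateralTrade.Environment m n) :
    ((∃ g, E.PassesFGP g) → ∀ g, E.IsRSW g → E.Undominated g) ∧
    (∀ g, E.IsRSW g → E.Undominated g → E.PassesFGP g) ∧
    ((∃ g, E.PassesFGP g) ↔ ∃ g, E.IsStrongSolution g) := by
  refine ⟨fun ⟨g, hg⟩ h hh => hg.undominated_of_isRSW hh,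
    fun g hR hU => hR.1.passesFGP_of_undominated hU, fun ⟨g, hg⟩ => ?_,
    fun ⟨g, hR, hU⟩ => ⟨g, hR.1.passesFGP_of_undominated hU⟩⟩
  obtain ⟨h, hh, -⟩ := hg.exists_isRSW
  exact ⟨h, hh, hg.undominated_of_isRSW hh⟩
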